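/- Let $\Phi\in\mathbb{R}^{M\times N}$, $Y\in\mathbb{R}^{M\times J}$ and $s\in\mathbb{N}$. Let $\|X\|_{2,0}$ be the number of nonzero rows of $X$, let $\mathcal{M}=\{X\in\mathbb{R}^{N\times J}:\|X\|_{2,0}\le s\}$, let $\mathcal{I}_{\mathcal{M}}$ be its indicator function ($0$ on $\mathcal{M}$, $+\infty$ elsewhere), and let $g(S)=\|Y-\Phi S\|_F^2$ for $S\in\mathbb{R}^{N\times J}$. Let $\ell\ge 0$ be a Lipschitz constant of $\nabla g$ with respect to the Frobenius norm (for example $\ell=2\|\Phi\|_F^2$) and let the penalty parameter satisfy $\rho>2\ell$. Starting from arbitrary $S^0,L^0\in\mathbb{R}^{N\times J}$, let the sequence $(B^k,S^k,L^k)$ be generated by Algorithm 1 (MMV-ADMM-$\ell_{2,0}$): for $k=0,1,2,\dots$ $$B^{k+1}\in\mathcal{P}_{\mathcal{M}}\left(S^k-\tfrac{1}{\rho}L^k\right),$$ $$S^{k+1}=(2\Phi^T\Phi+\rho I)^{-1}(2\Phi^TY+\rho B^{k+1}+L^k),$$ $$L^{k+1}=L^k+\rho(B^{k+1}-S^{k+1}),$$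 where $\mathcal{P}_{\mathcal{M}}(Z)$ is the set of all points of $\mathcal{M}$ nearest to $Z$ in the Frobenius norm (any choice is allowed when it is not a single point). Then the whole sequence $(B^k,S^k,L^k)$ converges to a point $(B^*,S^*,L^*)$ that is a KKT point of the problem $$\min_{B,S\in\mathbb{R}^{N\times J}}\ \|Y-\Phi S\|_F^2+\mathcal{I}_{\mathcal{M}}(B)\quad\text{subject to}\quad B-S=0,$$ that is, $2\Phi^T(\Phi S^*-Y)-L^*=\nabla g(S^*)-L^*=0$, $0\in\partial\mathcal{I}_{\mathcal{M}}(B^*)+L^*$ and $B^*-S^*=0$. Here $\partial$ is the limiting subdifferential: $v\in\partial f(x)$ if $f(x)$ is finite and there are $x_k\to x$ with $f(x_k)\to f(x)$ and $v_k\to v$ such that $f(x_k)$ is finite and $f(z)\ge f(x_k)+\langle v_k,z-x_k\rangle-o(\|z-x_k\|)$ as $z\to x_k$, for every $k$. -/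

import Mathlib

open Filter Topology Matrix
open scoped NNReal RealInnerProductSpace

/-! Real matrices carry the Frobenius norm and the Frobenius inner product. -/

attribute [local instance] Matrix.frobeniusNormedAddCommGroup Matrix.frobeniusNormedSpace

/-- The Frobenius inner product `⟪A, B⟫ = ∑ i, ∑ j, A i j * B i j` of real matrices; its norm is the
Frobenius norm. -/
@[reducible] noncomputable def frobeniusInnerProductSpace {m n : Type*} [Fintype m] [Fintype n] :
    InnerProductSpace ℝ (Matrix m n ℝ) where
  inner A B := ∑ i, ∑ j, A i j * B i j
  norm_sq_eq_re_inner A := by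
    rw [Matrix.frobenius_norm_def, ← Real.sqrt_eq_rpow, Real.sq_sqrt]
    · simp [sq]
    · positivity
  conj_inner_symm A B := by simp [mul_comm]
  add_left A B C := by simp [add_mul, Finset.sum_add_distrib]
  smul_left A B r := by simp [Finset.mul_sum, mul_assoc]

attribute [local instance] frobeniusInnerProductSpace

/-- A matrix space is complete for the Frobenius norm, being finite dimensional. -/
theorem frobenius_completeSpace {m n : Type*} [Fintype m] [Fintype n] :
    CompleteSpace (Matrix m n ℝ) :=
  FiniteDimensional.complete ℝ (Matrix m n ℝ)

attribute [local instance] frobenius_completeSpace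

section Variational

variable {E : Type*} [NormedAddCommGroup E] [InnerProductSpace ℝ E]

/-- The regular (Fréchet) subdifferential of `f` at `x`: the vectors `v` with
`f z ≥ f x + ⟪v, z - x⟫ + o(‖z - x‖)` as `z → x`. It is empty where `f` is not finite. -/
def regularSubdifferential (f : E → EReal) (x : E) : Set E :=
  {v | f x ≠ ⊤ ∧ f x ≠ ⊥ ∧ ∀ ε : ℝ, 0 < ε →
    ∀ᶠ z in 𝓝 x, f x + ((⟪v, z - x⟫ - ε * ‖z - x‖ : ℝ) : EReal) ≤ f z}

/-- The limiting subdifferential `∂f(x)`: the limits of regular subgradients `v k` of `f` at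
points `u k → x` with `f (u k) → f x`. It is empty where `f` is not finite. -/
def limitingSubdifferential (f : E → EReal) (x : E) : Set E :=
  {v | f x ≠ ⊤ ∧ f x ≠ ⊥ ∧ ∃ u w : ℕ → E,
    Tendsto u atTop (𝓝 x) ∧ Tendsto (fun k => f (u k)) atTop (𝓝 (f x)) ∧
    (∀ k, w k ∈ regularSubdifferential f (u k)) ∧ Tendsto w atTop (𝓝 v)}

open Classical in
/-- The indicator function of a set: `0` on the set and `+∞` off it. -/
noncomputable def indicatorFun (C : Set E) (x : E) : EReal := if x ∈ C then 0 else ⊤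

/-- The (set-valued) metric projection onto `C`: all points of `C` nearest to `z`. -/
def metricProj (C : Set E) (z : E) : Set E := {b | b ∈ C ∧ ∀ c ∈ C, ‖b - z‖ ≤ ‖c - z‖}

/-- `K` is a Lipschitz constant of the gradient of the differentiable function `g`. -/
def HasLipschitzGradient [CompleteSpace E] (g : E → ℝ) (K : ℝ≥0) : Prop :=
  (∀ x, DifferentiableAt ℝ g x) ∧ LipschitzWith K (gradient g)

/-- `(b, y, l)` is a KKT point of the problem: minimize `f b + g y` subject to `b - y = 0`, with
Lagrangian `f b + g y + ⟪l, b - y⟫`. The conditions are `0 = ∇g(y) - l`, `0 ∈ ∂f(b) + l` and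
`0 = b - y`. -/
structure IsKKTPoint [CompleteSpace E] (f : E → EReal) (g : E → ℝ) (b y l : E) : Prop where
  stationary_y : HasGradientAt g l y
  stationary_b : -l ∈ limitingSubdifferential f b
  feasible : b - y = 0

end Variational

section MMV

variable {M N J : ℕ}

/-- The `ℓ_{2,0}`-norm: the number of rows with nonzero Euclidean norm. -/
noncomputable def l20norm (X : Matrix (Fin N) (Fin J) ℝ) : ℕ :=
  {i : Fin N | ‖WithLp.toLp 2 (X i)‖ ≠ 0}.ncard

/-- The set `𝓜` of matrices of `ℓ_{2,0}`-norm at most `s`. -/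
def rowSparse (N J s : ℕ) : Set (Matrix (Fin N) (Fin J) ℝ) := {X | l20norm X ≤ s}

/-- The data fidelity term `S ↦ ‖Y - Φ S‖_F ^ 2`. -/
noncomputable def dataFit (Φ : Matrix (Fin M) (Fin N) ℝ) (Y : Matrix (Fin M) (Fin J) ℝ)
    (S : Matrix (Fin N) (Fin J) ℝ) : ℝ := ‖Y - Φ * S‖ ^ 2

/-- `(B k, S k, L k)` is generated by MMV-ADMM-`ℓ_{2,0}` with sparsity level `s` and penalty `ρ`,
from the arbitrary initial matrices `S 0` and `L 0` (`B 0` plays no role). Where the nearest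
point of `𝓜` is not unique, any choice is allowed. -/
structure IsMMVADMM (Φ : Matrix (Fin M) (Fin N) ℝ) (Y : Matrix (Fin M) (Fin J) ℝ) (s : ℕ) (ρ : ℝ)
    (B S L : ℕ → Matrix (Fin N) (Fin J) ℝ) : Prop where
  update_B : ∀ k, B (k + 1) ∈ metricProj (rowSparse N J s) (S k - (1 / ρ) • L k)
  update_S : ∀ k, S (k + 1) =
    ((2 : ℝ) • (Φᵀ * Φ) + ρ • (1 : Matrix (Fin N) (Fin N) ℝ))⁻¹ *
      ((2 : ℝ) • (Φᵀ * Y) + ρ • B (k + 1) + L k)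
  update_L : ∀ k, L (k + 1) = L k + ρ • (B (k + 1) - S (k + 1))

end MMV

/-! The row-sparse set is a finite union of subspaces, and on each subspace `V i` the least squares
objective has a minimum value `m i` and grows above it at most quadratically in its gradient along
`V i`. The augmented Lagrangian `H` drops by a multiple of the squared `S`-step, and this step
bounds that gradient, so `H (k + 1) - m i ≤ Q * (H k - H (k + 1))` for the subspace containing the
current `B`. Since `H` converges, so do these minimum values; being finitely many, they are
eventually constant, even if the subspace itself keeps changing. Then `H` converges geometrically,
the steps are summable and `S` is Cauchy (`cauchySeq`). `L` follows as the gradient at `S`, `B` from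
the dual step, and proximal normals pass to the limit. -/

section AbstractADMM

variable {E F : Type*} [NormedAddCommGroup E] [InnerProductSpace ℝ E]
  [NormedAddCommGroup F] [InnerProductSpace ℝ F]

/-- A Polyak–Łojasiewicz inequality for least squares over a subspace. -/
theorem exists_leastSquares_bound [FiniteDimensional ℝ E] (A : E →ₗ[ℝ] F) (y : F)
    (V : Submodule ℝ E) :
    ∃ m K : ℝ, 0 ≤ K ∧ ∀ b ∈ V, m ≤ ‖y - A b‖ ^ 2 ∧
      ∀ D : ℝ, 0 ≤ D → (∀ v ∈ V, 2 * ⟪A b - y, A v⟫ ≤ D * ‖v‖) →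
        ‖y - A b‖ ^ 2 ≤ m + K * D ^ 2 := by
  set φ : V →ₗ[ℝ] F := A.comp V.subtype with hφ
  -- `A` need not be injective on `V`. A bounded right inverse onto the range supplies a test vector
  -- for `A b - p` with norm at most `‖G'‖ * ‖A b - p‖`.
  obtain ⟨G, hG⟩ := φ.rangeRestrict.exists_rightInverse_of_surjective φ.range_rangeRestrict
  set G' := LinearMap.toContinuousLinearMap G
  set p : F := (LinearMap.range φ).starProjection y with hp
  have horth : ∀ w ∈ LinearMap.range φ, ⟪y - p, w⟫ = 0 := fun w hw =>
    Submodule.starProjection_inner_eq_zero y w hw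
  have hpm : p ∈ LinearMap.range φ := Submodule.starProjection_apply_mem _ _
  refine ⟨‖y - p‖ ^ 2, ‖G'‖ ^ 2, by positivity, fun b hb => ?_⟩
  have hw : A b - p ∈ LinearMap.range φ := Submodule.sub_mem _ ⟨⟨b, hb⟩, rfl⟩ hpm
  have hpyth : ‖y - A b‖ ^ 2 = ‖y - p‖ ^ 2 + ‖A b - p‖ ^ 2 := by
    have : y - A b = (y - p) - (A b - p) := by abel
    rw [this, norm_sub_sq_real, horth _ hw]; ring
  refine ⟨by rw [hpyth]; nlinarith [sq_nonneg ‖A b - p‖], fun D hD hbD => ?_⟩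
  set w : LinearMap.range φ := ⟨A b - p, hw⟩ with hwdef
  have hAv : A (G' w : E) = A b - p := by
    have := congrArg Subtype.val (LinearMap.congr_fun hG w)
    simpa [hφ, hwdef, G'] using this
  have hv : ‖(G' w : E)‖ ≤ ‖G'‖ * ‖A b - p‖ := G'.le_opNorm w
  have h1 := hbD (G' w) (G' w).2
  have h2 : ⟪A b - y, A b - p⟫ = ‖A b - p‖ ^ 2 := by
    have : A b - y = (A b - p) - (y - p) := by abel
    rw [this, inner_sub_left, horth _ hw, real_inner_self_eq_norm_sq, sub_zero]
  rw [hAv, h2] at h1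
  have h3 : 2 * ‖A b - p‖ ^ 2 ≤ D * (‖G'‖ * ‖A b - p‖) := h1.trans (by gcongr)
  have h4 : ‖A b - p‖ ≤ ‖G'‖ * D := by
    by_contra! h
    have h0 : 0 < ‖A b - p‖ := lt_of_le_of_lt (by positivity) h
    nlinarith
  have h5 : ‖A b - p‖ ^ 2 ≤ (‖G'‖ * D) ^ 2 := by gcongr
  rw [hpyth]; nlinarith

/-- A sequence converging to `a` with values in a finite set is eventually equal to `a`. -/
theorem Filter.Tendsto.eventually_eq_of_finite_range {X ι κ : Type*} [TopologicalSpace X]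
    [T1Space X] [Finite ι] {f : ι → X} {i : κ → ι} {l : Filter κ} {a : X}
    (h : Tendsto (fun k => f (i k)) l (𝓝 a)) : ∀ᶠ k in l, f (i k) = a := by
  have hopen : IsOpen (Set.range f \ {a})ᶜ := (Set.toFinite _).isClosed.isOpen_compl
  filter_upwards [h.eventually (hopen.mem_nhds (by simp))] with k hk
  by_contra hne
  exact hk ⟨⟨i k, rfl⟩, hne⟩

/-! ### Projections onto nonconvex sets and subgradients -/

theorem inner_le_of_mem_metricProj {C : Set E} {z b c : E} (hb : b ∈ metricProj C z)
    (hc : c ∈ C) : ⟪z - b, c - b⟫ ≤ ‖c - b‖ ^ 2 / 2 := by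
  have h := pow_le_pow_left₀ (norm_nonneg _) (hb.2 c hc) 2
  have e1 : c - z = (c - b) - (z - b) := by abel
  rw [e1, norm_sub_sq_real (c - b), norm_sub_rev b z, real_inner_comm] at h
  linarith

theorem inner_eq_zero_of_mem_metricProj {C : Set E} {V : Submodule ℝ E} (hV : (V : Set E) ⊆ C)
    {z b v : E} (hb : b ∈ metricProj C z) (hbV : b ∈ V) (hv : v ∈ V) : ⟪z - b, v⟫ = 0 := by
  have key : ∀ t : ℝ, t * ⟪z - b, v⟫ ≤ t ^ 2 * ‖v‖ ^ 2 / 2 := fun t => by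
    have h := inner_le_of_mem_metricProj hb (hV (V.add_mem hbV (V.smul_mem t hv)))
    rwa [add_sub_cancel_left, inner_smul_right, norm_smul, mul_pow, Real.norm_eq_abs,
      sq_abs] at h
  by_contra hne
  set a := ⟪z - b, v⟫
  -- The linear term in `t` would beat the quadratic one for small `t`; the `+ 1` covers `v = 0`.
  have h1 := key (a / (‖v‖ ^ 2 + 1))
  have ha : 0 < a ^ 2 := by positivity
  have hq : 0 < ‖v‖ ^ 2 + 1 := by positivity
  have h2 : a ^ 2 * (‖v‖ ^ 2 + 1) ≤ a ^ 2 * ‖v‖ ^ 2 / 2 := by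
    have := mul_le_mul_of_nonneg_right h1 (sq_nonneg (‖v‖ ^ 2 + 1))
    field_simp at this
    nlinarith
  nlinarith [mul_nonneg ha.le (sq_nonneg ‖v‖)]

theorem smul_sub_mem_regularSubdifferential {C : Set E} {z b : E} (hb : b ∈ metricProj C z)
    {r : ℝ} (hr : 0 < r) : r • (z - b) ∈ regularSubdifferential (indicatorFun C) b := by
  have hbC : indicatorFun C b = 0 := if_pos hb.1
  refine ⟨by simp [hbC], by simp [hbC], fun ε hε => ?_⟩
  -- On this ball the error `r * ‖c - b‖ ^ 2 / 2` is at most `ε * ‖c - b‖`.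
  filter_upwards [Metric.ball_mem_nhds b (show 0 < 2 * ε / r by positivity)] with c hc
  by_cases hcC : c ∈ C
  · rw [hbC, show indicatorFun C c = 0 from if_pos hcC, zero_add]
    norm_cast
    have h := inner_le_of_mem_metricProj hb hcC
    rw [Metric.mem_ball, dist_eq_norm, lt_div_iff₀ hr] at hc
    rw [inner_smul_left]
    simp only [conj_trivial]
    have h1 := mul_le_mul_of_nonneg_left h hr.le
    nlinarith [norm_nonneg (c - b)]
  · rw [show indicatorFun C c = ⊤ from if_neg hcC]
    exact le_top

theorem HasGradientAt.of_leastSquares [FiniteDimensional ℝ E] [CompleteSpace E] (A : E →ₗ[ℝ] F)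
    (T : F →ₗ[ℝ] E) (hT : ∀ x y, ⟪T y, x⟫ = ⟪y, A x⟫) (y : F) (x : E) :
    HasGradientAt (fun x => ‖y - A x‖ ^ 2) ((2 : ℝ) • T (A x - y)) x := by
  rw [hasGradientAt_iff_hasFDerivAt]
  have h := ((LinearMap.toContinuousLinearMap A).hasFDerivAt (x := x)).const_sub y |>.norm_sq
  refine h.congr_fderiv ?_
  ext v
  simp only [InnerProductSpace.toDual_apply_apply, inner_smul_left, hT]
  simp [inner_sub_left]

/-! ### Descent estimates for the augmented Lagrangian -/

/-- The ADMM recursion for minimizing `‖y - A x‖ ^ 2` over `x ∈ C`, with the optimality condition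
of the `S`-step in place of its closed form. -/
structure IsLeastSquaresADMM (A : E →ₗ[ℝ] F) (T : F →ₗ[ℝ] E) (y : F) (C : Set E) (ρ : ℝ)
    (B S L : ℕ → E) : Prop where
  mem_proj : ∀ k, B (k + 1) ∈ metricProj C (S k - (1 / ρ) • L k)
  stationary : ∀ k, L (k + 1) = (2 : ℝ) • T (A (S (k + 1)) - y)
  dual_step : ∀ k, L (k + 1) = L k + ρ • (B (k + 1) - S (k + 1))

/-- The augmented Lagrangian. -/
noncomputable def augLagrangian (A : E →ₗ[ℝ] F) (y : F) (ρ : ℝ) (b s l : E) : ℝ :=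
  ‖y - A s‖ ^ 2 + ⟪l, b - s⟫ + ρ / 2 * ‖b - s‖ ^ 2

variable {A : E →ₗ[ℝ] F} {T : F →ₗ[ℝ] E} {y : F}

theorem norm_sq_residual_eq (hT : ∀ x y, ⟪T y, x⟫ = ⟪y, A x⟫) (b s : E) :
    ‖y - A b‖ ^ 2 = ‖y - A s‖ ^ 2 + ⟪(2 : ℝ) • T (A s - y), b - s⟫ + ‖A (b - s)‖ ^ 2 := by
  have e : y - A b = (y - A s) - A (b - s) := by rw [map_sub]; abel
  rw [e, norm_sub_sq_real, inner_smul_left, hT, ← neg_sub y (A s), inner_neg_left]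
  simp only [conj_trivial]
  ring

theorem norm_map_sq_le (hT : ∀ x y, ⟪T y, x⟫ = ⟪y, A x⟫) {K : ℝ}
    (hK : ∀ x, ‖(2 : ℝ) • T (A x)‖ ≤ K * ‖x‖) (x : E) : ‖A x‖ ^ 2 ≤ K / 2 * ‖x‖ ^ 2 := by
  have h1 : ⟪(2 : ℝ) • T (A x), x⟫ = 2 * ‖A x‖ ^ 2 := by
    rw [inner_smul_left, hT, real_inner_self_eq_norm_sq]; simp
  have h2 := real_inner_le_norm ((2 : ℝ) • T (A x)) x
  nlinarith [mul_le_mul_of_nonneg_right (hK x) (norm_nonneg x)]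

theorem augLagrangian_eq (hT : ∀ x y, ⟪T y, x⟫ = ⟪y, A x⟫) (ρ : ℝ) (b s : E) :
    augLagrangian A y ρ b s ((2 : ℝ) • T (A s - y)) =
      ‖y - A b‖ ^ 2 - ‖A (b - s)‖ ^ 2 + ρ / 2 * ‖b - s‖ ^ 2 := by
  rw [augLagrangian, norm_sq_residual_eq hT b s]; ring

/-- Completing the square in `b` turns the augmented Lagrangian into a squared distance plus a
constant. -/
theorem augLagrangian_le_of_mem_metricProj {C : Set E} {ρ : ℝ} (hρ : 0 < ρ) {b c s l : E}
    (hb : b ∈ metricProj C (s - (1 / ρ) • l)) (hc : c ∈ C) :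
    augLagrangian A y ρ b s l ≤ augLagrangian A y ρ c s l := by
  have key : ∀ x, ρ / 2 * ‖x - (s - (1 / ρ) • l)‖ ^ 2 =
      ⟪l, x - s⟫ + ρ / 2 * ‖x - s‖ ^ 2 + ρ / 2 * ‖(1 / ρ) • l‖ ^ 2 := fun x => by
    rw [show x - (s - (1 / ρ) • l) = (x - s) + (1 / ρ) • l by abel, norm_add_sq_real,
      inner_smul_right, real_inner_comm]
    field_simp
    ring
  have h := pow_le_pow_left₀ (norm_nonneg _) (hb.2 c hc) 2
  have h' := mul_le_mul_of_nonneg_left h (show 0 ≤ ρ / 2 by positivity)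
  rw [key, key] at h'
  unfold augLagrangian
  linarith

namespace IsLeastSquaresADMM

variable {C : Set E} {ρ K : ℝ} {B S L : ℕ → E}

/-- Multipliers are gradients only from index 1 on, as `L 0` is arbitrary; hence the shifted
indices. -/
theorem norm_dual_step_le (h : IsLeastSquaresADMM A T y C ρ B S L)
    (hK : ∀ x, ‖(2 : ℝ) • T (A x)‖ ≤ K * ‖x‖) (k : ℕ) :
    ‖L (k + 2) - L (k + 1)‖ ≤ K * ‖S (k + 2) - S (k + 1)‖ := by
  have e : L (k + 2) - L (k + 1) = (2 : ℝ) • T (A (S (k + 2) - S (k + 1))) := by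
    rw [h.stationary (k + 1), h.stationary k, ← smul_sub, ← map_sub, map_sub A]
    congr 2; abel
  rw [e]; exact hK _

theorem norm_primal_residual_le (h : IsLeastSquaresADMM A T y C ρ B S L) (hρ : 0 < ρ)
    (hK : ∀ x, ‖(2 : ℝ) • T (A x)‖ ≤ K * ‖x‖) (k : ℕ) :
    ‖B (k + 2) - S (k + 2)‖ ≤ K / ρ * ‖S (k + 2) - S (k + 1)‖ := by
  have h1 := h.norm_dual_step_le hK k
  rw [h.dual_step (k + 1), add_sub_cancel_left, norm_smul, Real.norm_of_nonneg hρ.le] at h1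
  rw [div_mul_eq_mul_div, le_div_iff₀ hρ]
  linarith

/-- The `B`-step does not increase the value, the `S`-step gains at least `ρ / 2 * ‖d‖ ^ 2`, and the
dual step costs `ρ * ‖r‖ ^ 2 ≤ K ^ 2 / ρ * ‖d‖ ^ 2`. -/
theorem augLagrangian_descent (h : IsLeastSquaresADMM A T y C ρ B S L) (hρ : 0 < ρ)
    (hT : ∀ x y, ⟪T y, x⟫ = ⟪y, A x⟫) (hK : ∀ x, ‖(2 : ℝ) • T (A x)‖ ≤ K * ‖x‖) (k : ℕ) :
    augLagrangian A y ρ (B (k + 2)) (S (k + 2)) (L (k + 2)) +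
        (ρ / 2 - K ^ 2 / ρ) * ‖S (k + 2) - S (k + 1)‖ ^ 2 ≤
      augLagrangian A y ρ (B (k + 1)) (S (k + 1)) (L (k + 1)) := by
  have h1 := augLagrangian_le_of_mem_metricProj (A := A) (y := y) hρ (h.mem_proj (k + 1))
    (h.mem_proj k).1
  refine le_trans ?_ h1
  have h2 := norm_sq_residual_eq (y := y) hT (S (k + 1)) (S (k + 2))
  rw [← h.stationary (k + 1)] at h2
  have h3 := h.norm_primal_residual_le hρ hK k
  have h4 := h.dual_step (k + 1)
  show augLagrangian A y ρ (B (k + 2)) (S (k + 2)) (L (k + 2)) + _ ≤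
    augLagrangian A y ρ (B (k + 2)) _ _
  change L (k + 2) = L (k + 1) + ρ • (B (k + 2) - S (k + 2)) at h4
  set r := B (k + 2) - S (k + 2) with hr
  set d := S (k + 1) - S (k + 2) with hd
  have e : B (k + 2) - S (k + 1) = r - d := by rw [hr, hd]; abel
  rw [norm_sub_rev (S (k + 2)), ← hd] at h3 ⊢
  have h5 : ‖r‖ ^ 2 ≤ (K / ρ * ‖d‖) ^ 2 := by gcongr
  have h6 : ρ * ‖r‖ ^ 2 ≤ K ^ 2 / ρ * ‖d‖ ^ 2 := by
    calc ρ * ‖r‖ ^ 2 ≤ ρ * (K / ρ * ‖d‖) ^ 2 := by gcongr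
      _ = _ := by field_simp
  unfold augLagrangian
  rw [← hr, e, norm_sub_sq_real r d, h2, h4]
  simp only [inner_add_left, inner_sub_right, inner_smul_left, conj_trivial,
    real_inner_self_eq_norm_sq]
  nlinarith [sq_nonneg ‖A d‖]

theorem le_augLagrangian (h : IsLeastSquaresADMM A T y C ρ B S L) (hρ : K ≤ ρ)
    (hT : ∀ x y, ⟪T y, x⟫ = ⟪y, A x⟫) (hK : ∀ x, ‖(2 : ℝ) • T (A x)‖ ≤ K * ‖x‖) (k : ℕ) :
    ‖y - A (B (k + 1))‖ ^ 2 ≤ augLagrangian A y ρ (B (k + 1)) (S (k + 1)) (L (k + 1)) := by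
  rw [h.stationary, augLagrangian_eq hT]
  have := norm_map_sq_le hT hK (B (k + 1) - S (k + 1))
  nlinarith [sq_nonneg ‖B (k + 1) - S (k + 1)‖]

theorem augLagrangian_le (h : IsLeastSquaresADMM A T y C ρ B S L) (hρ : 0 < ρ)
    (hT : ∀ x y, ⟪T y, x⟫ = ⟪y, A x⟫) (hK : ∀ x, ‖(2 : ℝ) • T (A x)‖ ≤ K * ‖x‖) (k : ℕ) :
    augLagrangian A y ρ (B (k + 2)) (S (k + 2)) (L (k + 2)) ≤
      ‖y - A (B (k + 2))‖ ^ 2 + ρ / 2 * (K / ρ) ^ 2 * ‖S (k + 2) - S (k + 1)‖ ^ 2 := by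
  rw [h.stationary (k + 1), augLagrangian_eq hT]
  have h1 := pow_le_pow_left₀ (norm_nonneg _) (h.norm_primal_residual_le hρ hK k) 2
  have h2 := mul_le_mul_of_nonneg_left h1 (show 0 ≤ ρ / 2 by positivity)
  rw [mul_pow] at h2
  nlinarith [sq_nonneg ‖A (B (k + 1 + 1) - S (k + 1 + 1))‖]

/-- On a subspace contained in `C`, the gradient of the objective along the subspace is controlled
by the last step. -/
theorem two_mul_inner_le (h : IsLeastSquaresADMM A T y C ρ B S L) (hρ : 0 < ρ) (hK0 : 0 ≤ K)
    (hT : ∀ x y, ⟪T y, x⟫ = ⟪y, A x⟫) (hK : ∀ x, ‖(2 : ℝ) • T (A x)‖ ≤ K * ‖x‖) (k : ℕ)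
    {V : Submodule ℝ E} (hV : (V : Set E) ⊆ C) (hB : B (k + 2) ∈ V) {v : E} (hv : v ∈ V) :
    2 * ⟪A (B (k + 2)) - y, A v⟫ ≤
      (K + ρ) * (K / ρ + 1) * ‖S (k + 2) - S (k + 1)‖ * ‖v‖ := by
  -- Along `V` the projection residual vanishes, so there `L (k + 1)` acts as `-ρ • x`.
  have h0 := inner_eq_zero_of_mem_metricProj hV (h.mem_proj (k + 1)) hB hv
  set x := B (k + 2) - S (k + 1) with hx
  have hxn : ‖x‖ ≤ (K / ρ + 1) * ‖S (k + 2) - S (k + 1)‖ := by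
    have : x = (B (k + 2) - S (k + 2)) + (S (k + 2) - S (k + 1)) := by rw [hx]; abel
    rw [this]
    refine (norm_add_le _ _).trans ?_
    linarith [h.norm_primal_residual_le hρ hK k]
  have h1 : ⟪L (k + 1), v⟫ = -(ρ * ⟪x, v⟫) := by
    have e : S (k + 1) - (1 / ρ) • L (k + 1) - B (k + 1 + 1) = -x - (1 / ρ) • L (k + 1) := by
      rw [hx]; abel
    rw [e, inner_sub_left, inner_neg_left, inner_smul_left] at h0
    simp only [conj_trivial] at h0
    field_simp at h0
    linarith
  have h2 : 2 * ⟪A (B (k + 2)) - y, A v⟫ = ⟪(2 : ℝ) • T (A x), v⟫ - ρ * ⟪x, v⟫ := by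
    have : A (B (k + 2)) - y = A x + (A (S (k + 1)) - y) := by rw [hx, map_sub]; abel
    rw [sub_eq_add_neg _ (ρ * ⟪x, v⟫), ← h1, h.stationary k, this]
    simp only [inner_add_left, inner_smul_left, hT, conj_trivial]
    ring
  have h3 := (real_inner_le_norm ((2 : ℝ) • T (A x)) v).trans
    (mul_le_mul_of_nonneg_right (hK x) (norm_nonneg v))
  have h4 := neg_le_of_abs_le (abs_real_inner_le_norm x v)
  have h5 : (K + ρ) * ‖x‖ ≤ (K + ρ) * ((K / ρ + 1) * ‖S (k + 2) - S (k + 1)‖) := by gcongr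
  have h6 := mul_le_mul_of_nonneg_right h5 (norm_nonneg v)
  nlinarith

/-! ### Geometric convergence and the limit -/

theorem cauchySeq [FiniteDimensional ℝ E] {ι : Type*} [Finite ι] {V : ι → Submodule ℝ E}
    (hV : ∀ x, x ∈ C ↔ ∃ i, x ∈ V i) (h : IsLeastSquaresADMM A T y C ρ B S L)
    (hK0 : 0 ≤ K) (hρ : 2 * K < ρ)
    (hT : ∀ x y, ⟪T y, x⟫ = ⟪y, A x⟫) (hK : ∀ x, ‖(2 : ℝ) • T (A x)‖ ≤ K * ‖x‖) :
    CauchySeq S := by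
  have hρ0 : 0 < ρ := by linarith
  choose m κ hκ0 hm using fun i => exists_leastSquares_bound A y (V i)
  choose i hi using fun k => (hV _).1 (h.mem_proj k).1
  obtain ⟨κ₀, hκ₀⟩ : BddAbove (Set.range κ) := (Set.finite_range κ).bddAbove
  set c := ρ / 2 - K ^ 2 / ρ with hc
  have hcpos : 0 < c := by
    rw [hc, sub_pos, div_lt_div_iff₀ hρ0 two_pos]; nlinarith
  set D := (K + ρ) * (K / ρ + 1)
  have hD : 0 ≤ D := by positivity
  set H : ℕ → ℝ := fun k => augLagrangian A y ρ (B (k + 1)) (S (k + 1)) (L (k + 1)) with hH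
  set δ : ℕ → ℝ := fun k => ‖S (k + 2) - S (k + 1)‖ with hδ
  have hdesc : ∀ k, H (k + 1) + c * δ k ^ 2 ≤ H k :=
    fun k => h.augLagrangian_descent hρ0 hT hK k
  -- Numerator: total coefficient of `δ k ^ 2` in the gap above `m`; dividing by `c` trades `δ k ^
  -- 2` for the decrease of `H`.
  set Q := (max κ₀ 0 * D ^ 2 + ρ / 2 * (K / ρ) ^ 2) / c with hQ
  have hQ0 : 0 ≤ Q := by positivity
  have hlow : ∀ k, m (i k) ≤ H k := fun k =>
    ((hm (i k) _ (hi k)).1).trans (h.le_augLagrangian (by linarith) hT hK k)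
  have hup : ∀ k, H (k + 1) ≤ m (i (k + 1)) + Q * (H k - H (k + 1)) := fun k => by
    have h1 := (hm (i (k + 1)) _ (hi (k + 1))).2 (D * δ k) (by positivity)
      (fun v hv => h.two_mul_inner_le hρ0 hK0 hT hK k
        (fun x hx => (hV x).2 ⟨_, hx⟩) (hi (k + 1)) hv)
    have h2 := h.augLagrangian_le hρ0 hT hK k
    have h3 : κ (i (k + 1)) * (D * δ k) ^ 2 ≤ max κ₀ 0 * (D * δ k) ^ 2 := by
      gcongr; exact (hκ₀ ⟨_, rfl⟩).trans (le_max_left _ _)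
    have h4 : Q * (c * δ k ^ 2) ≤ Q * (H k - H (k + 1)) := by
      gcongr; linarith [hdesc k]
    have h5 : Q * (c * δ k ^ 2) =
        max κ₀ 0 * (D * δ k) ^ 2 + ρ / 2 * (K / ρ) ^ 2 * δ k ^ 2 := by
      rw [hQ]; field_simp
    change H (k + 1) ≤ ‖y - A (B (k + 1 + 1))‖ ^ 2 + ρ / 2 * (K / ρ) ^ 2 * δ k ^ 2 at h2
    linarith
  have hanti : Antitone H := antitone_nat_of_succ_le fun k => by
    nlinarith [hdesc k, sq_nonneg (δ k)]
  obtain ⟨a, ha⟩ : ∃ a, Tendsto H atTop (𝓝 a) := by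
    refine ⟨_, tendsto_atTop_ciInf hanti ⟨0, ?_⟩⟩
    rintro _ ⟨k, rfl⟩
    exact (sq_nonneg _).trans (h.le_augLagrangian (by linarith) hT hK k)
  have ha1 : Tendsto (fun k => H (k + 1)) atTop (𝓝 a) := ha.comp (tendsto_add_atTop_nat 1)
  have hmlim : Tendsto (fun k => m (i (k + 1))) atTop (𝓝 a) := by
    refine tendsto_of_tendsto_of_tendsto_of_le_of_le
      (g := fun k => H (k + 1) - Q * (H k - H (k + 1))) ?_ ha1
      (fun k => by linarith [hup k]) (fun k => hlow (k + 1))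
    simpa using ha1.sub ((ha.sub ha1).const_mul Q)
  obtain ⟨n, hn⟩ := eventually_atTop.1 hmlim.eventually_eq_of_finite_range
  have hge : ∀ k, a ≤ H k := fun k => hanti.le_of_tendsto ha k
  -- Solves `(1 + Q) * (H (k + 1) - a) ≤ Q * (H k - a)`.
  set q := Q / (1 + Q) with hq
  have hq0 : 0 ≤ q := by positivity
  have hq1 : q < 1 := by rw [hq, div_lt_one (by positivity)]; linarith
  have hgeom : ∀ k, H (n + k) - a ≤ (H n - a) * q ^ k := fun k => by
    induction k with
    | zero => simp
    | succ k ih =>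
      have h1 := hup (n + k)
      rw [hn (n + k) (by omega)] at h1
      have h2 : H (n + k + 1) - a ≤ q * (H (n + k) - a) := by
        rw [hq, div_mul_eq_mul_div, le_div_iff₀ (by positivity)]; nlinarith
      calc H (n + (k + 1)) - a ≤ q * (H (n + k) - a) := h2
        _ ≤ q * ((H n - a) * q ^ k) := by gcongr
        _ = _ := by ring
  have hstep : ∀ k, δ (n + k) ≤ √((H n - a) / c) * √q ^ k := fun k => by
    have hna : 0 ≤ H n - a := sub_nonneg.2 (hge n)
    refine abs_le_of_sq_le_sq' ?_ (by positivity) |>.2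
    rw [mul_pow, Real.sq_sqrt (by positivity), ← pow_mul, mul_comm k, pow_mul,
      Real.sq_sqrt hq0, div_mul_eq_mul_div, le_div_iff₀ hcpos]
    linarith [hdesc (n + k), hge (n + k + 1), hgeom k]
  have hcs : CauchySeq fun k => S (k + (n + 1)) := by
    refine cauchySeq_of_le_geometric (√q) (√((H n - a) / c))
      ((Real.sqrt_lt' one_pos).2 (by simpa using hq1)) fun k => ?_
    rw [dist_comm, dist_eq_norm]
    have := hstep k
    simp only [hδ] at this
    rwa [show n + k + 2 = k + 1 + (n + 1) by ring, show n + k + 1 = k + (n + 1) by ring] at this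
  exact (cauchySeq_shift (n + 1)).1 hcs

theorem exists_tendsto_isKKTPoint [FiniteDimensional ℝ E] [CompleteSpace E] {ι : Type*} [Finite ι]
    {V : ι → Submodule ℝ E}
    (hV : ∀ x, x ∈ C ↔ ∃ i, x ∈ V i) (h : IsLeastSquaresADMM A T y C ρ B S L)
    (hK0 : 0 ≤ K) (hρ : 2 * K < ρ)
    (hT : ∀ x y, ⟪T y, x⟫ = ⟪y, A x⟫) (hK : ∀ x, ‖(2 : ℝ) • T (A x)‖ ≤ K * ‖x‖) :
    ∃ b s l : E, Tendsto (fun k => (B k, S k, L k)) atTop (𝓝 (b, s, l)) ∧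
      IsKKTPoint (indicatorFun C) (fun x => ‖y - A x‖ ^ 2) b s l := by
  have hρ0 : 0 < ρ := by linarith
  obtain ⟨s, hs⟩ := cauchySeq_tendsto_of_complete (h.cauchySeq hV hK0 hρ hT hK)
  have hs1 := hs.comp (tendsto_add_atTop_nat 1)
  set l := (2 : ℝ) • T (A s - y) with hl
  have hgrad : Continuous fun x => (2 : ℝ) • (T ∘ₗ A) x - (2 : ℝ) • T y :=
    ((LinearMap.continuous_of_finiteDimensional (T ∘ₗ A)).const_smul _).sub continuous_const
  have hL : Tendsto L atTop (𝓝 l) := by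
    rw [← tendsto_add_atTop_iff_nat 1]
    have := (hgrad.tendsto s).comp hs1
    convert this using 2 with k
    · simp [h.stationary, smul_sub]
    · simp [hl, smul_sub]
  have hL1 := hL.comp (tendsto_add_atTop_nat 1)
  have hB1 : Tendsto (fun k => B (k + 1)) atTop (𝓝 s) := by
    have e : (fun k => B (k + 1)) = fun k => S (k + 1) + (1 / ρ) • (L (k + 1) - L k) := by
      funext k
      rw [h.dual_step k, add_sub_cancel_left, smul_smul, one_div_mul_cancel hρ0.ne', one_smul]
      abel
    rw [e]
    simpa using hs1.add ((hL1.sub hL).const_smul (1 / ρ))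
  have hB : Tendsto B atTop (𝓝 s) := (tendsto_add_atTop_iff_nat 1).1 hB1
  have hclosed : IsClosed C := by
    have : C = ⋃ i, (V i : Set E) := by ext x; simp [hV]
    rw [this]
    exact isClosed_iUnion_of_finite fun i => (V i).closed_of_finiteDimensional
  have hsC : s ∈ C := hclosed.mem_of_tendsto hB1 (Eventually.of_forall fun k => (h.mem_proj k).1)
  have hval : ∀ x ∈ C, indicatorFun C x = 0 := fun x hx => if_pos hx
  refine ⟨s, s, l, hB.prodMk_nhds (hs.prodMk_nhds hL),
    HasGradientAt.of_leastSquares A T hT y s, ⟨by simp [hval s hsC], by simp [hval s hsC],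
    fun k => B (k + 1), fun k => ρ • (S k - (1 / ρ) • L k - B (k + 1)), hB1, ?_,
    fun k => smul_sub_mem_regularSubdifferential (h.mem_proj k) hρ0, ?_⟩, sub_self s⟩
  · simp only [hval _ (h.mem_proj _).1, hval s hsC]
    exact tendsto_const_nhds
  -- The subgradients tend to `ρ • (s - (1 / ρ) • l - s) = -l`.
  · have := ((hs.sub (hL.const_smul (1 / ρ))).sub hB1).const_smul ρ
    convert this using 2
    rw [sub_sub_cancel_left, smul_neg, smul_smul, mul_one_div_cancel hρ0.ne', one_smul]

end IsLeastSquaresADMM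

end AbstractADMM

/-! ### Specialization to row-sparse matrices -/

section MMVConvergence

variable {M N J : ℕ}

/-- Left multiplication by a matrix. -/
def mulLeftLinear (J : ℕ) (Φ : Matrix (Fin M) (Fin N) ℝ) :
    Matrix (Fin N) (Fin J) ℝ →ₗ[ℝ] Matrix (Fin M) (Fin J) ℝ where
  toFun X := Φ * X
  map_add' := Matrix.mul_add Φ
  map_smul' r X := Matrix.mul_smul Φ r X

theorem inner_eq_trace (X Z : Matrix (Fin N) (Fin J) ℝ) : ⟪X, Z⟫ = (Xᵀ * Z).trace := by
  change ∑ i, ∑ j, X i j * Z i j = _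
  rw [Finset.sum_comm]
  rfl

theorem inner_transpose_mul (Φ : Matrix (Fin M) (Fin N) ℝ) (X : Matrix (Fin N) (Fin J) ℝ)
    (Z : Matrix (Fin M) (Fin J) ℝ) : ⟪Φᵀ * Z, X⟫ = ⟪Z, Φ * X⟫ := by
  rw [inner_eq_trace, inner_eq_trace, Matrix.transpose_mul, Matrix.transpose_transpose,
    Matrix.mul_assoc]

/-- Matrices whose rows outside `I` vanish. -/
def rowSupported (J : ℕ) (I : Finset (Fin N)) : Submodule ℝ (Matrix (Fin N) (Fin J) ℝ) where
  carrier := {X | ∀ i ∉ I, X i = 0}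
  add_mem' hX hZ i hi := (congrArg₂ (· + ·) (hX i hi) (hZ i hi)).trans (add_zero 0)
  zero_mem' _ _ := rfl
  smul_mem' r _ hX i hi := (congrArg (r • ·) (hX i hi)).trans (smul_zero r)

theorem mem_rowSparse_iff {s : ℕ} (X : Matrix (Fin N) (Fin J) ℝ) :
    X ∈ rowSparse N J s ↔
      ∃ I : {I : Finset (Fin N) // I.card ≤ s}, X ∈ rowSupported J I.1 := by
  classical
  have hcard : l20norm X = (Finset.univ.filter fun i => X i ≠ 0).card := by
    rw [l20norm, ← Set.ncard_coe_finset]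
    congr 1
    ext i
    simp
  change l20norm X ≤ s ↔ _
  rw [hcard]
  constructor
  · intro h
    exact ⟨⟨_, h⟩, fun i hi => by simpa using hi⟩
  · rintro ⟨⟨I, hI⟩, hX⟩
    refine (Finset.card_le_card fun i hi => ?_).trans hI
    by_contra hiI
    exact (Finset.mem_filter.1 hi).2 (hX i hiI)

theorem isUnit_det_gram_add_smul_one (Φ : Matrix (Fin M) (Fin N) ℝ) {ρ : ℝ} (hρ : 0 < ρ) :
    IsUnit ((2 : ℝ) • (Φᵀ * Φ) + ρ • (1 : Matrix (Fin N) (Fin N) ℝ)).det := by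
  have h1 : (Φᵀ * Φ).PosSemidef := by
    simpa using Matrix.posSemidef_conjTranspose_mul_self Φ
  have h2 : ((2 : ℝ) • (Φᵀ * Φ) + ρ • (1 : Matrix (Fin N) (Fin N) ℝ)).PosDef :=
    Matrix.PosDef.posSemidef_add (h1.smul zero_le_two) (Matrix.PosDef.one.smul hρ)
  exact h2.det_pos.ne'.isUnit

theorem IsMMVADMM.isLeastSquaresADMM {Φ : Matrix (Fin M) (Fin N) ℝ}
    {Y : Matrix (Fin M) (Fin J) ℝ} {s : ℕ} {ρ : ℝ} {B S L : ℕ → Matrix (Fin N) (Fin J) ℝ}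
    (h : IsMMVADMM Φ Y s ρ B S L) (hρ : 0 < ρ) :
    IsLeastSquaresADMM (mulLeftLinear J Φ) (mulLeftLinear J Φᵀ) Y (rowSparse N J s) ρ B S L where
  mem_proj := h.update_B
  dual_step := h.update_L
  stationary k := by
    change _ = (2 : ℝ) • (Φᵀ * (Φ * S (k + 1) - Y))
    -- Clearing the inverse gives the normal equations; inserting the dual update leaves the
    -- gradient identity.
    have h1 := congrArg
      (((2 : ℝ) • (Φᵀ * Φ) + ρ • (1 : Matrix (Fin N) (Fin N) ℝ)) * ·) (h.update_S k)
    rw [Matrix.mul_nonsing_inv_cancel_left _ _ (isUnit_det_gram_add_smul_one Φ hρ),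
      Matrix.add_mul, Matrix.smul_mul, Matrix.smul_mul, Matrix.one_mul, Matrix.mul_assoc] at h1
    rw [h.update_L k, Matrix.mul_sub, smul_sub, smul_sub, ← sub_eq_zero]
    rw [← sub_eq_zero] at h1
    rw [← neg_eq_zero, ← h1]
    abel

end MMVConvergence

theorem theorem5p2 {M N J : ℕ} (Φ : Matrix (Fin M) (Fin N) ℝ) (Y : Matrix (Fin M) (Fin J) ℝ)
    (s : ℕ) (Lip : ℝ≥0) (hLip : HasLipschitzGradient (dataFit (N := N) Φ Y) Lip)
    (ρ : ℝ) (hρ : 2 * (Lip : ℝ) < ρ)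
    (B S L : ℕ → Matrix (Fin N) (Fin J) ℝ) (hBSL : IsMMVADMM Φ Y s ρ B S L) :
    ∃ Blim Slim Llim : Matrix (Fin N) (Fin J) ℝ,
      Tendsto (fun k => (B k, S k, L k)) atTop (𝓝 (Blim, Slim, Llim)) ∧
        IsKKTPoint (indicatorFun (rowSparse N J s)) (dataFit Φ Y) Blim Slim Llim := by
  have hρ0 : 0 < ρ := lt_of_le_of_lt (by positivity) hρ
  have hT : ∀ x y, ⟪mulLeftLinear J Φᵀ y, x⟫ = ⟪y, mulLeftLinear J Φ x⟫ :=
    fun x y => inner_transpose_mul Φ x y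
  have hgrad : ∀ x, gradient (dataFit (N := N) Φ Y) x =
      (2 : ℝ) • mulLeftLinear J Φᵀ (mulLeftLinear J Φ x - Y) := fun x =>
    (HasGradientAt.of_leastSquares (mulLeftLinear J Φ) (mulLeftLinear J Φᵀ) hT Y x).gradient
  have hK : ∀ x, ‖(2 : ℝ) • mulLeftLinear J Φᵀ (mulLeftLinear J Φ x)‖ ≤ Lip * ‖x‖ := fun x => by
    -- The gradient is affine, so comparing with `0` isolates its linear part.
    have h := hLip.2.dist_le_mul x 0
    rw [dist_eq_norm, dist_eq_norm, hgrad, hgrad, ← smul_sub, ← map_sub] at h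
    simpa using h
  exact (hBSL.isLeastSquaresADMM hρ0).exists_tendsto_isKKTPoint mem_rowSparse_iff Lip.2 hρ hT hK
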